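/- Quantum systems $A',B',A,B,R$ are described by nonzero separable complex Hilbert spaces of finite or infinite dimension $|A'|,|B'|,\dots\in\{1,2,\dots,\infty\}$; $\log$ is to base $2$, and $\log\infty=+\infty$. Let $\mathrm{St}(X)$ be the set of density operators of a system $X$, and $\mathrm{Q}(X',X)$ the set of quantum channels from $X'$ to $X$, i.e. of completely positive trace-preserving linear maps between the spaces of trace-class operators. Let $\mathcal R_{A'\to A}(X)=\operatorname{tr}(X)\,\mathbb 1_A$ be the completely mixing map, and let $D(\rho\Vert\sigma)=\lim_{\varepsilon\to0^+}\operatorname{tr}\big(\rho\,(\log(\rho+\varepsilon\mathbb 1)-\log(\sigma+\varepsilon\mathbb 1))\big)\in[-\infty,+\infty]$ be the Umegaki relative entropy of a state $\rho$ and a positive bounded operator $\sigma$ (read as the upper limit in the degenerate infinite-dimensional cases in which the limit need not exist); in finite dimension, $D(\rho\Vert\sigma)=\operatorname{tr}(\rho(\log\rho-\log\sigma))$ if $\operatorname{supp}\rho\subseteq\operatorname{supp}\sigma$, and $D(\rho\Vert\sigma)=+\infty$ otherwise. For a channel $\mathcal N$ and a completely positive map $\mathcal M$ with the same input system $X'$,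 put $$D[\mathcal N\Vert\mathcal M]=\sup_{R,\ \rho\in\mathrm{St}(RX')}D\big((\mathrm{id}_R\otimes\mathcal N)(\rho)\,\big\Vert\,(\mathrm{id}_R\otimes\mathcal M)(\rho)\big).$$ The von Neumann conditional entropy of a bipartite channel $\mathcal N\in\mathrm{Q}(A'B',AB)$ is $$S[A|B]_{\mathcal N}=-\inf_{\mathcal M\in\mathrm{Q}(B',B)}D[\mathcal N_{A'B'\to AB}\Vert\mathcal R_{A'\to A}\otimes\mathcal M_{B'\to B}].$$ The channel $\mathcal N$ is called semicausal from $A'$ to $B$ if there is a channel $\widetilde{\mathcal N}\in\mathrm{Q}(B',B)$ with $\operatorname{tr}_A\circ\,\mathcal N_{A'B'\to AB}=\operatorname{tr}_{A'}\otimes\widetilde{\mathcal N}_{B'\to B}$; otherwise it is said to be signaling, or to have causal influence, from $A'$ to $B$. It is called unitary if $\mathcal N(X)=UXU^\dagger$ for a unitary operator $U$ from the Hilbert space of $A'B'$ onto that of $AB$. Let $\mathcal N\in\mathrm{Q}(A'B',AB)$. 1. If $\mathcal N$ is semicausal from $A'$ to $B$, then $S[A|B]_{\mathcal N}\ge-\log|A|$.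 2. If $\mathcal N$ is semicausal from $A'$ to $B$ and unitary, then $S[A|B]_{\mathcal N}=-\log|A|$. 3. If $S[A|B]_{\mathcal N}<-\log|A|$, then $\mathcal N$ has causal influence (is signaling) from $A'$ to $B$. -/

import Mathlib

open scoped ComplexOrder Kronecker Topology InnerProductSpace lp

noncomputable section

namespace QChannel

/-! A quantum system with separable Hilbert space, of finite or countably infinite dimension, is
given by a countable type `ι` that labels an orthonormal basis: its Hilbert space is `ℓ²(ι, ℂ)`,
its dimension is the number of elements of `ι`, and the composite of `ι` and `κ` is `ι × κ`.
Operators are written as (possibly infinite) matrices in these bases. -/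

/-- Trace-class operators on `ℓ²(ι, ℂ)`: the linear span of the positive semidefinite matrices with
summable diagonal (these are exactly the matrices of the positive operators of finite trace). -/
def TraceClass (ι : Type*) : Submodule ℂ (Matrix ι ι ℂ) :=
  Submodule.span ℂ {X | X.PosSemidef ∧ Summable fun i => X i i}

/-- The trace of a trace-class operator. -/
def tr {ι : Type*} (X : TraceClass ι) : ℂ := ∑' i, X.1 i i

/-- Density operators: positive trace-class operators of unit trace. -/
def IsState {ι : Type*} (ρ : TraceClass ι) : Prop := ρ.1.PosSemidef ∧ tr ρ = 1

/-! ### Blocks and partial traces of trace-class operators -/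

theorem norm_entry_le {ι : Type*} {X : Matrix ι ι ℂ} (hX : X.PosSemidef) (i j : ι) :
    ‖X i j‖ ≤ ‖X i i‖ + ‖X j j‖ := by
  have key : ∀ c : ℂ, 0 ≤ X i i + c * X i j + star c * X j i + star c * c * X j j := by
    intro c
    have h := (hX.submatrix ![i, j]).dotProduct_mulVec_nonneg ![1, c]
    simp only [dotProduct, Matrix.mulVec, Fin.sum_univ_two, Matrix.submatrix_apply, Pi.star_apply,
      Matrix.cons_val_zero, Matrix.cons_val_one, star_one] at h
    convert h using 1
    ring
  have hji : X j i = star (X i j) := (hX.1.apply j i).symm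
  obtain ⟨c, hc1, hc2⟩ : ∃ c : ℂ, star c * c = 1 ∧ c * X i j = -(‖X i j‖ : ℂ) := by
    by_cases h0 : X i j = 0
    · exact ⟨1, by simp, by simp [h0]⟩
    · have hn : (‖X i j‖ : ℂ) ≠ 0 := by simpa using h0
      have hm : star (X i j) * X i j = (‖X i j‖ : ℂ) ^ 2 := by
        simpa using Complex.conj_mul' (X i j)
      refine ⟨-(star (X i j) / (‖X i j‖ : ℂ)), ?_, ?_⟩
      · have : star (-(star (X i j) / (‖X i j‖ : ℂ))) = -(X i j / (‖X i j‖ : ℂ)) := by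
          simp
        rw [this]
        field_simp
        linear_combination hm
      · field_simp
        linear_combination -hm
  have h := key c
  have h2 : star c * X j i = -(‖X i j‖ : ℂ) := by
    rw [hji, ← star_mul', hc2]; simp
  rw [hc2, h2, hc1, one_mul] at h
  have hre := (Complex.le_def.1 h).1
  simp only [Complex.zero_re, Complex.add_re, Complex.neg_re, Complex.ofReal_re] at hre
  have a1 := Complex.re_le_norm (X i i)
  have a2 := Complex.re_le_norm (X j j)
  have a3 := norm_nonneg (X i j)
  linarith

/-- The block `⟨r| X |s⟩`, an operator on `ι`, of an operator `X` on `R × ι`. -/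
def blockMatrix {R ι : Type*} (r s : R) : Matrix (R × ι) (R × ι) ℂ →ₗ[ℂ] Matrix ι ι ℂ where
  toFun X := X.submatrix (Prod.mk r) (Prod.mk s)
  map_add' _ _ := rfl
  map_smul' _ _ := rfl

theorem blockMatrix_apply {R ι : Type*} (r s : R) (X : Matrix (R × ι) (R × ι) ℂ) (i j : ι) :
    blockMatrix r s X i j = X (r, i) (s, j) := rfl

theorem blockMatrix_comb_mem {R ι : Type*} (r s : R) {X : Matrix (R × ι) (R × ι) ℂ}
    (hX : X.PosSemidef) (hs : Summable fun i => X i i) (c : ℂ) :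
    blockMatrix r r X + c • blockMatrix r s X + star c • blockMatrix s r X
      + (star c * c) • blockMatrix s s X ∈ TraceClass ι := by
  classical
  have hsr : ∀ t : R, Summable fun i : ι => ‖X (t, i) (t, i)‖ := fun t =>
    hs.norm.comp_injective (Prod.mk_right_injective t)
  have hoff : ∀ t u : R, Summable fun i : ι => X (t, i) (u, i) := fun t u =>
    Summable.of_norm_bounded ((hsr t).add (hsr u)) fun i => norm_entry_le hX _ _
  refine Submodule.subset_span ⟨⟨?_, fun x => ?_⟩, ?_⟩
  · ext i j
    have h1 := hX.1.apply (r, i) (r, j)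
    have h2 := hX.1.apply (r, i) (s, j)
    have h3 := hX.1.apply (s, i) (r, j)
    have h4 := hX.1.apply (s, i) (s, j)
    simp only [blockMatrix_apply, Matrix.conjTranspose_apply, Matrix.add_apply, Matrix.smul_apply,
      smul_eq_mul, star_add, star_mul', star_star, h1, h2, h3, h4]
    ring
  · have h := hX.2 (x.mapDomain (Prod.mk r) + (x.mapDomain (Prod.mk s)).mapRange (c * ·) (by simp))
    convert h using 1
    have e : ∀ (F : R × ι → ℂ → ℂ), (∀ p, F p 0 = 0) → (∀ p a b, F p (a + b) = F p a + F p b) →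
        (x.mapDomain (Prod.mk r) + (x.mapDomain (Prod.mk s)).mapRange (c * ·) (by simp)).sum F
          = x.sum fun i a => F (r, i) a + F (s, i) (c * a) := by
      intro F h0 hadd
      rw [Finsupp.sum_add_index' h0 hadd, Finsupp.sum_mapRange_index h0,
        Finsupp.sum_mapDomain_index h0 hadd, Finsupp.sum_mapDomain_index
          (by simp [h0]) (by simp [mul_add, hadd]), Finsupp.sum_add]
    rw [e _ (by simp) (by intros; simp [add_mul, Finsupp.sum_add])]
    refine Finsupp.sum_congr fun i _ => ?_
    rw [e _ (by simp) (by intros; ring), e _ (by simp) (by intros; ring), ← Finsupp.sum_add]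
    refine Finsupp.sum_congr fun j _ => ?_
    simp only [blockMatrix_apply, Matrix.add_apply, Matrix.smul_apply, smul_eq_mul, star_mul']
    ring
  · exact (((hoff r r).add ((hoff r s).mul_left c)).add ((hoff s r).mul_left (star c))).add
      ((hoff s s).mul_left (star c * c))

theorem blockMatrix_mem {R ι : Type*} (r s : R) {X : Matrix (R × ι) (R × ι) ℂ}
    (hX : X ∈ TraceClass (R × ι)) : blockMatrix r s X ∈ TraceClass ι := by
  suffices h : TraceClass (R × ι) ≤ (TraceClass ι).comap (blockMatrix r s) from h hX
  refine Submodule.span_le.2 ?_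
  rintro X ⟨hX, hs⟩
  have hc := blockMatrix_comb_mem r s hX hs
  have h4 : blockMatrix r s X = (1 / 4 : ℂ) •
      ((blockMatrix r r X + (1 : ℂ) • blockMatrix r s X + star (1 : ℂ) • blockMatrix s r X
          + (star (1 : ℂ) * 1) • blockMatrix s s X)
        - (blockMatrix r r X + (-1 : ℂ) • blockMatrix r s X + star (-1 : ℂ) • blockMatrix s r X
          + (star (-1 : ℂ) * (-1)) • blockMatrix s s X)
        - Complex.I • (blockMatrix r r X + Complex.I • blockMatrix r s X
          + star Complex.I • blockMatrix s r X + (star Complex.I * Complex.I) • blockMatrix s s X)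
        + Complex.I • (blockMatrix r r X + (-Complex.I) • blockMatrix r s X
          + star (-Complex.I) • blockMatrix s r X
          + (star (-Complex.I) * (-Complex.I)) • blockMatrix s s X)) := by
    ext i j
    simp only [Matrix.add_apply, Matrix.sub_apply, Matrix.smul_apply, smul_eq_mul, star_one,
      star_neg, Complex.star_def, Complex.conj_I]
    linear_combination (1 / 2 : ℂ) * (blockMatrix r s X i j - blockMatrix s r X i j) * Complex.I_sq
  change blockMatrix r s X ∈ TraceClass ι
  rw [h4]
  exact Submodule.smul_mem _ _ (Submodule.add_mem _ (Submodule.sub_mem _ (Submodule.sub_mem _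
    (hc 1) (hc (-1))) (Submodule.smul_mem _ _ (hc _))) (Submodule.smul_mem _ _ (hc _)))

/-- The block `⟨r| X |s⟩` of a trace-class operator `X` on `R × ι`. -/
def block {R ι : Type*} (r s : R) (X : TraceClass (R × ι)) : TraceClass ι :=
  ⟨blockMatrix r s X.1, blockMatrix_mem r s X.2⟩

theorem summable_fiber {ι κ : Type*} {X : Matrix (ι × κ) (ι × κ) ℂ} (hX : X ∈ TraceClass (ι × κ))
    (k l : κ) : Summable fun i => X (i, k) (i, l) := by
  unfold TraceClass at hX
  induction hX using Submodule.span_induction with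
  | mem X h =>
    have hn : ∀ t : κ, Summable fun i : ι => ‖X (i, t) (i, t)‖ := fun t =>
      h.2.norm.comp_injective (Prod.mk_left_injective t)
    exact Summable.of_norm_bounded ((hn k).add (hn l)) fun i => norm_entry_le h.1 _ _
  | zero => simp
  | add X Y _ _ hX hY => exact hX.add hY
  | smul c X _ hX => exact hX.mul_left c

theorem partialTrace_mem {ι κ : Type*} {X : Matrix (ι × κ) (ι × κ) ℂ}
    (hX : X ∈ TraceClass (ι × κ)) :
    (Matrix.of fun k l => ∑' i, X (i, k) (i, l)) ∈ TraceClass κ := by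
  have hX' := hX
  unfold TraceClass at hX'
  induction hX' using Submodule.span_induction with
  | mem X h =>
    have hf := summable_fiber hX
    refine Submodule.subset_span ⟨⟨?_, fun x => ?_⟩, ?_⟩
    · ext k l
      simp only [Matrix.conjTranspose_apply, Matrix.of_apply, tsum_star]
      exact tsum_congr fun i => h.1.1.apply _ _
    · have e : (x.sum fun k a => x.sum fun l b =>
            star a * (Matrix.of fun k l => ∑' i, X (i, k) (i, l)) k l * b)
          = ∑' i, x.sum fun k a => x.sum fun l b => star a * X (i, k) (i, l) * b := by
        simp only [Finsupp.sum, Matrix.of_apply]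
        rw [Summable.tsum_finsetSum fun k _ => summable_sum fun l _ =>
          ((hf k l).mul_left _).mul_right _]
        refine Finset.sum_congr rfl fun k _ => ?_
        rw [Summable.tsum_finsetSum fun l _ => ((hf k l).mul_left _).mul_right _]
        refine Finset.sum_congr rfl fun l _ => ?_
        rw [tsum_mul_right, tsum_mul_left]
      rw [e]
      exact tsum_nonneg fun i => (h.1.submatrix (Prod.mk i)).2 x
    · exact h.2.prod_symm.prod
  | zero =>
    convert (TraceClass κ).zero_mem
    ext k l
    simp
  | add X Y hX1 hY1 hX2 hY2 =>
    convert (TraceClass κ).add_mem (hX2 hX1) (hY2 hY1) using 1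
    ext k l
    exact (summable_fiber hX1 k l).tsum_add (summable_fiber hY1 k l)
  | smul c X hX1 hX2 =>
    convert (TraceClass κ).smul_mem c (hX2 hX1) using 1
    ext k l
    exact tsum_mul_left

/-- The partial trace over the first factor. -/
def partialTrace (ι κ : Type*) : TraceClass (ι × κ) →ₗ[ℂ] TraceClass κ where
  toFun X := ⟨Matrix.of fun k l => ∑' i, X.1 (i, k) (i, l), partialTrace_mem X.2⟩
  map_add' X Y := by
    ext k l
    exact (summable_fiber X.2 k l).tsum_add (summable_fiber Y.2 k l)
  map_smul' c X := by
    ext k l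
    exact tsum_mul_left

/-! ### Channels -/

/-- `id_R ⊗ Φ`, evaluated at `X`: the map `Φ` is applied to every block of `X`. The values of `Φ`
need not be of trace class. -/
def amplify {R ι κ : Type*} (Φ : TraceClass ι →ₗ[ℂ] Matrix κ κ ℂ) (X : TraceClass (R × ι)) :
    Matrix (R × κ) (R × κ) ℂ :=
  Matrix.of fun p q => Φ (block p.1 q.1 X) p.2 q.2

/-- Complete positivity: all the maps `id ⊗ Φ` with a finite-dimensional ancilla are positive. -/
def IsCompletelyPositive {ι κ : Type*} (Φ : TraceClass ι →ₗ[ℂ] Matrix κ κ ℂ) : Prop :=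
  ∀ (n : ℕ) (X : TraceClass (Fin n × ι)), X.1.PosSemidef → (amplify Φ X).PosSemidef

/-- Quantum channels: completely positive trace-preserving linear maps. -/
structure Channel (ι κ : Type*) where
  map : TraceClass ι →ₗ[ℂ] TraceClass κ
  completelyPositive : IsCompletelyPositive ((TraceClass κ).subtype ∘ₗ map)
  trace_preserving : ∀ X, tr (map X) = tr X

/-- A channel as a map into the space of all operators. -/
def Channel.toOperators {ι κ : Type*} (N : Channel ι κ) : TraceClass ι →ₗ[ℂ] Matrix κ κ ℂ :=
  (TraceClass κ).subtype ∘ₗ N.map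

open Classical in
/-- `R_{A'→A} ⊗ M`, where `R_{A'→A}(X) = tr(X) 1_A` is the completely mixing map and `M` is a
channel from `B'` to `B`: the map `X ↦ 1_A ⊗ M(tr_{A'} X)`. -/
def mixingTensor {A' B' B : Type*} (A : Type*) (M : Channel B' B) :
    TraceClass (A' × B') →ₗ[ℂ] Matrix (A × B) (A × B) ℂ where
  toFun X := (1 : Matrix A A ℂ) ⊗ₖ (M.map (partialTrace A' B' X)).1
  map_add' X Y := by simp [Matrix.kronecker_add]
  map_smul' c X := by simp [Matrix.kronecker_smul]

/-- `N` is semicausal (no-signaling) from `A'` to `B`: `tr_A ∘ N = tr_{A'} ⊗ Ñ` for some channel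
`Ñ` from `B'` to `B`. -/
def IsSemicausal {A' B' A B : Type*} (N : Channel (A' × B') (A × B)) : Prop :=
  ∃ Nred : Channel B' B, ∀ X : TraceClass (A' × B'),
    partialTrace A B (N.map X) = Nred.map (partialTrace A' B' X)

/-- `N` is signaling from `A'` to `B`, i.e. has causal influence from `A'` to `B`. -/
def IsSignaling {A' B' A B : Type*} (N : Channel (A' × B') (A × B)) : Prop := ¬ IsSemicausal N

/-! ### Operators on `ℓ²` and relative entropy -/

open Classical in
/-- The bounded operator on `ℓ²(ι, ℂ)` with the given matrix; it exists for the matrices of trace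
class and for the values of `mixingTensor` and of its amplifications. -/
def toOp {ι : Type*} (X : Matrix ι ι ℂ) : ℓ²(ι, ℂ) →L[ℂ] ℓ²(ι, ℂ) :=
  if h : ∃ T : ℓ²(ι, ℂ) →L[ℂ] ℓ²(ι, ℂ), ∀ i j, T (lp.single 2 j (1 : ℂ)) i = X i j then
    h.choose
  else 0

/-- `N` is a unitary channel: `N(X) = U X U†` for a unitary operator `U`. -/
def IsUnitaryChannel {ι κ : Type*} (N : Channel ι κ) : Prop :=
  ∃ U : ℓ²(ι, ℂ) ≃ₗᵢ[ℂ] ℓ²(κ, ℂ), ∀ (X : TraceClass ι) (v : ℓ²(κ, ℂ)),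
    toOp (N.map X).1 v = U (toOp X.1 (U.symm v))

open Classical in
/-- The real number `tr(ρ (log(ρ + ε 1) - log(σ + ε 1)))`, with logarithms to base 2 defined by the
continuous functional calculus. -/
def regRelEntropy {ι : Type*} (ρ σ : Matrix ι ι ℂ) (ε : ℝ) : ℝ :=
  (∑' i, (toOp ρ ((CFC.log (toOp ρ + ε • 1) - CFC.log (toOp σ + ε • 1)) (lp.single 2 i (1 : ℂ))) i
    ).re) / Real.log 2

/-- The Umegaki relative entropy `D(ρ‖σ)` (base 2) of a state `ρ` and a positive bounded operator
`σ`, as the limit of `tr(ρ (log(ρ + ε 1) - log(σ + ε 1)))` for `ε → 0+`.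
In finite dimension this limit is `tr(ρ (log ρ - log σ))` if the support of `ρ` lies in that of `σ`,
and `+∞` otherwise. In infinite dimension, for spectral decompositions `ρ = ∑ pᵢ |φᵢ⟩⟨φᵢ|` and
`σ = ∑ qⱼ |χⱼ⟩⟨χⱼ|`, it is `∑ pᵢ |⟨φᵢ|χⱼ⟩|² (log pᵢ - log qⱼ)` whenever the positive or the negative
part of this sum is finite (by monotone convergence of both parts); this avoids the difference
of `tr(ρ log ρ)` and `tr(ρ log σ)`, both of which may be infinite. -/
def relEntropy {ι : Type*} (ρ σ : Matrix ι ι ℂ) : EReal :=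
  Filter.limsup (fun ε : ℝ => (regRelEntropy ρ σ ε : EReal)) (𝓝[>] 0)

/-- The channel relative entropy `D[Φ‖Ψ]`: the supremum of `D((id_R ⊗ Φ)(ρ)‖(id_R ⊗ Ψ)(ρ))` over all
reference systems `R` with separable Hilbert space and all states `ρ` of `R × ι`. -/
def channelRelEntropy {ι κ : Type*} (Φ Ψ : TraceClass ι →ₗ[ℂ] Matrix κ κ ℂ) : EReal :=
  ⨆ (R : Type) (_ : Countable R) (ρ : TraceClass (R × ι)) (_ : IsState ρ),
    relEntropy (amplify Φ ρ) (amplify Ψ ρ)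

/-- The von Neumann conditional entropy
`S[A|B]_N = - inf_{M ∈ Q(B',B)} D[N ‖ R_{A'→A} ⊗ M]` of a bipartite channel. -/
def condEntropy {A' B' A B : Type*} (N : Channel (A' × B') (A × B)) : EReal :=
  -⨅ M : Channel B' B, channelRelEntropy N.toOperators (mixingTensor A M)

open Classical in
/-- `log |A|` (base 2), with value `+∞` if `|A| = ∞`. -/
def logDim (A : Type*) : EReal :=
  if Finite A then ((Real.logb 2 (Nat.card A) : ℝ) : EReal) else ⊤

end QChannel

end

open QChannel

noncomputable section

namespace QChannel

open Matrix

/-! For a semicausal `N` with reduced channel `M`, the output `τ` of `M` is the partial trace over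
`A` of the output `ω` of `N`, and pinching gives `ω ≤ |A| • (1 ⊗ τ)`. Since `log` is operator
monotone, every regularized relative entropy of `ω` and `1 ⊗ τ` is at most `log |A|`, so `M`
witnesses `S[A|B] ≥ -log |A|`.

If `N` is unitary, every pure state is an output of `id ⊗ N`, in particular the maximally entangled
state `φ` of `n` levels of the reference system with `n ≤ |A|` levels of `A`. For every state `τ`,
`⟨φ|1 ⊗ τ|φ⟩ ≤ 1 / n`, because `1 ⊗ τ` is diagonal in `A`. The tangent bound for the concave
function `log` turns this into `D(φ‖1 ⊗ τ) ≥ log n`, whatever the channel that produced `τ`. Taking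
`n = |A|`, or letting `n` grow if `|A| = ∞`, bounds `S[A|B]` by `-log |A|`. -/

/-! ### Positive semidefinite matrices of arbitrary size -/

section PosSemidef

variable {ι κ : Type*}

theorem posSemidef_of_forall_finset {X : Matrix ι ι ℂ}
    (h : ∀ s : Finset ι, (X.submatrix ((↑) : s → ι) (↑)).PosSemidef) : X.PosSemidef := by
  classical
  refine ⟨?_, fun x => ?_⟩
  · ext i j
    exact (h {i, j}).isHermitian.apply ⟨i, by simp⟩ ⟨j, by simp⟩
  · have hx := (h x.support).dotProduct_mulVec_nonneg fun i => x i
    simp only [dotProduct, mulVec, Pi.star_apply, submatrix_apply, Finset.mul_sum,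
      ← mul_assoc] at hx
    rw [Finsupp.sum, ← Finset.sum_coe_sort]
    simp_rw [Finsupp.sum]
    convert hx using 2 with i
    exact (Finset.sum_coe_sort x.support fun j => star (x i) * X i j * x j).symm

theorem isClosed_setOf_posSemidef : IsClosed {X : Matrix ι ι ℂ | X.PosSemidef} := by
  have entry (i j : ι) : Continuous fun X : Matrix ι ι ℂ => X i j := continuous_id.matrix_elem i j
  have hset : {X : Matrix ι ι ℂ | X.PosSemidef} = {X | Xᴴ = X} ∩
      ⋂ x : ι →₀ ℂ, {X | 0 ≤ x.sum fun i a => x.sum fun j b => star a * X i j * b} := by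
    ext X
    simp [Matrix.PosSemidef, IsHermitian]
  rw [hset]
  refine (isClosed_eq continuous_id.matrix_conjTranspose continuous_id).inter
    (isClosed_iInter fun x => isClosed_le continuous_const ?_)
  exact continuous_finsetSum _ fun i _ => continuous_finsetSum _ fun j _ =>
    (continuous_const.mul (entry i j)).mul continuous_const

theorem posSemidef_of_hasSum {F : κ → Matrix ι ι ℂ} {X : Matrix ι ι ℂ} (hF : HasSum F X)
    (h : ∀ k, (F k).PosSemidef) : X.PosSemidef :=
  isClosed_setOf_posSemidef.mem_of_tendsto hF
    (.of_forall fun s => posSemidef_sum s fun k _ => h k)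

theorem posSemidef_vecMulVec_star (u : ι → ℂ) : (vecMulVec u (star u)).PosSemidef :=
  posSemidef_of_forall_finset fun s =>
    posSemidef_vecMulVec_self_star fun i : s => u i

theorem posSemidef_kronecker {X : Matrix ι ι ℂ} {Y : Matrix κ κ ℂ} (hX : X.PosSemidef)
    (hY : Y.PosSemidef) : (X ⊗ₖ Y).PosSemidef :=
  (hX.submatrix Prod.fst).hadamard (hY.submatrix Prod.snd)

theorem posSemidef_card_smul_one_sub_vecMulVec_one [Fintype ι] [DecidableEq ι] :
    ((Fintype.card ι : ℂ) • (1 : Matrix ι ι ℂ) - vecMulVec 1 1).PosSemidef := by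
  cases isEmpty_or_nonempty ι
  · rw [Subsingleton.elim (_ - _) (0 : Matrix ι ι ℂ)]
    exact .zero
  set n : ℂ := (Fintype.card ι : ℂ)
  set J : Matrix ι ι ℂ := vecMulVec 1 1
  have hn : n ≠ 0 := Nat.cast_ne_zero.2 Fintype.card_ne_zero
  have hJ : Jᴴ = J := by simp only [J, conjTranspose_vecMulVec, star_one]
  have hJJ : J * J = n • J := by
    rw [vecMulVec_mul_vecMulVec, one_dotProduct_one, vecMulVec_smul]
  have hsq : n • 1 - J = n⁻¹ • ((n • 1 - J)ᴴ * (n • 1 - J)) := by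
    have hH : (n • 1 - J)ᴴ = n • 1 - J := by
      simp only [conjTranspose_sub, conjTranspose_smul, conjTranspose_one, hJ, n, star_natCast]
    rw [hH, eq_inv_smul_iff₀ hn]
    simp only [mul_sub, sub_mul, hJJ, smul_mul_assoc, mul_smul_comm, one_mul, mul_one, smul_sub]
    abel
  rw [hsq]
  exact (posSemidef_conjTranspose_mul_self _).smul (inv_nonneg.2 (Nat.cast_nonneg _))

theorem posSemidef_card_smul_kronecker_sum_block_sub [Fintype ι] [DecidableEq ι]
    {X : Matrix (ι × κ) (ι × κ) ℂ} (hX : X.PosSemidef) :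
    ((Fintype.card ι : ℂ) • ((1 : Matrix ι ι ℂ) ⊗ₖ ∑ i, blockMatrix i i X) - X).PosSemidef := by
  set J : Matrix ι ι ℂ := vecMulVec 1 1
  -- The first summand compares `X` with its block diagonal part, by the pinching inequality; the
  -- second one replaces every diagonal block by the sum of all diagonal blocks.
  have hsplit : (Fintype.card ι : ℂ) • ((1 : Matrix ι ι ℂ) ⊗ₖ ∑ i, blockMatrix i i X) - X
      = X ⊙ ((Fintype.card ι : ℂ) • 1 - J).submatrix Prod.fst Prod.fst
        + (Fintype.card ι : ℂ) • ∑ i, diagonal (1 - Pi.single i 1) ⊗ₖ blockMatrix i i X := by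
    ext ⟨i, k⟩ ⟨j, l⟩
    rcases eq_or_ne i j with rfl | hij
    · simp [J, Matrix.sum_apply, sub_mul, Pi.single_apply, blockMatrix_apply, mul_sub]
      ring
    · simp [J, Matrix.sum_apply, hij]
  rw [hsplit]
  refine (hX.hadamard (posSemidef_card_smul_one_sub_vecMulVec_one.submatrix _)).add
    (.smul (posSemidef_sum _ fun i _ => posSemidef_kronecker (.diagonal ?_) (hX.submatrix _))
      (Nat.cast_nonneg _))
  intro j
  by_cases h : j = i <;> simp [h]

theorem norm_entry_sq_le {X : Matrix ι ι ℂ} (hX : X.PosSemidef) (i j : ι) :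
    ‖X i j‖ ^ 2 ≤ ‖X i i‖ * ‖X j j‖ := by
  have hdet := (hX.submatrix ![i, j]).det_nonneg
  have hentry : X i j * X j i = (‖X i j‖ : ℂ) ^ 2 := by
    rw [← hX.isHermitian.apply j i, Complex.star_def, Complex.mul_conj']
  simp only [det_fin_two, submatrix_apply, cons_val_zero, cons_val_one, hentry, sub_nonneg] at hdet
  rw [Complex.eq_coe_norm_of_nonneg hX.diag_nonneg,
    Complex.eq_coe_norm_of_nonneg (z := X j j) hX.diag_nonneg] at hdet
  exact_mod_cast hdet

end PosSemidef

/-! ### Bounded operators on `ℓ²` and their matrices -/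

section Matrices

variable {ι κ α : Type*}

theorem tsum_enorm_sq (v : ℓ²(ι, ℂ)) : ∑' i, ‖v i‖ₑ ^ 2 = ‖v‖ₑ ^ 2 := by
  have h : HasSum (fun i => ‖v i‖ ^ 2) (‖v‖ ^ 2) := by
    simpa using lp.hasSum_norm (p := 2) (by simp) v
  simp only [← ofReal_norm, ← ENNReal.ofReal_pow (norm_nonneg _)]
  rw [← ENNReal.ofReal_tsum_of_nonneg (fun _ => by positivity) h.summable, h.tsum_eq]

theorem memℓp_two_of_tsum_enorm_sq_ne_top {f : ι → ℂ} (h : ∑' i, ‖f i‖ₑ ^ 2 ≠ ⊤) :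
    Memℓp f 2 := by
  refine memℓp_gen ((ENNReal.summable_toReal h).congr fun i => ?_)
  simp

theorem exists_clm_of_tsum_enorm_sq_le {E : Type*} [NormedAddCommGroup E] [NormedSpace ℂ E]
    (L : ι → E →ₗ[ℂ] ℂ) (C : NNReal) (h : ∀ v, ∑' i, ‖L i v‖ₑ ^ 2 ≤ (C * ‖v‖ₑ) ^ 2) :
    ∃ T : E →L[ℂ] ℓ²(ι, ℂ), ∀ v i, T v i = L i v := by
  have hmem (v : E) : Memℓp (fun i => L i v) 2 :=
    memℓp_two_of_tsum_enorm_sq_ne_top ((h v).trans_lt (by finiteness)).ne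
  let T : E →ₗ[ℂ] ℓ²(ι, ℂ) :=
    { toFun v := ⟨fun i => L i v, hmem v⟩
      map_add' v w := by ext i; exact map_add (L i) v w
      map_smul' c v := by ext i; exact map_smul (L i) c v }
  refine ⟨T.mkContinuous C fun v => ?_, fun v i => rfl⟩
  have hv : ‖T v‖ₑ ≤ C * ‖v‖ₑ := by
    rw [← ENNReal.pow_le_pow_left_iff two_ne_zero, ← tsum_enorm_sq]
    exact h v
  simpa [enorm_eq_nnnorm, ← ENNReal.coe_mul, ← NNReal.coe_le_coe] using hv

theorem exists_clm_apply_eq_comp {f : κ → ι} (hf : Function.Injective f) :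
    ∃ T : ℓ²(ι, ℂ) →L[ℂ] ℓ²(κ, ℂ), ∀ v k, T v k = v (f k) := by
  refine exists_clm_of_tsum_enorm_sq_le
    (fun k => (lp.evalCLM ℂ (fun _ : ι => ℂ) 2 (f k)).toLinearMap) 1 fun v => ?_
  rw [ENNReal.coe_one, one_mul, ← tsum_enorm_sq]
  exact ENNReal.tsum_comp_le_tsum_of_injective hf fun i => ‖v i‖ₑ ^ 2

/-- The standard orthonormal basis `|i⟩` of `ℓ²(ι, ℂ)`. -/
def ket (ι : Type*) : HilbertBasis ι ℂ ℓ²(ι, ℂ) := .ofRepr (.refl ℂ _)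

theorem inner_ket_left (i : ι) (v : ℓ²(ι, ℂ)) : ⟪ket ι i, v⟫_ℂ = v i :=
  ((ket ι).repr_apply_apply v i).symm

theorem inner_ket_right (i : ι) (v : ℓ²(ι, ℂ)) : ⟪v, ket ι i⟫_ℂ = star (v i) := by
  rw [← inner_conj_symm, inner_ket_left, Complex.star_def]

theorem ket_apply [DecidableEq ι] (i j : ι) : ket ι j i = if i = j then 1 else 0 := by
  rw [← inner_ket_left]
  exact orthonormal_iff_ite.1 (ket ι).orthonormal i j

/-- The bounded operator `T` has the matrix `X` in the standard bases. -/
def HasMatrix (T : ℓ²(κ, ℂ) →L[ℂ] ℓ²(ι, ℂ)) (X : Matrix ι κ ℂ) : Prop :=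
  ∀ i j, T (ket κ j) i = X i j

namespace HasMatrix

variable {S T : ℓ²(κ, ℂ) →L[ℂ] ℓ²(ι, ℂ)} {X Y : Matrix ι κ ℂ}

theorem unique (hS : HasMatrix S X) (hT : HasMatrix T X) : S = T := by
  refine ContinuousLinearMap.ext_on
    (Submodule.dense_iff_topologicalClosure_eq_top.2 (ket κ).dense_span) ?_
  rintro _ ⟨j, rfl⟩
  ext i
  rw [hS, hT]

theorem add (hS : HasMatrix S X) (hT : HasMatrix T Y) : HasMatrix (S + T) (X + Y) := fun i j =>
  congrArg₂ (· + ·) (hS i j) (hT i j)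

theorem sub (hS : HasMatrix S X) (hT : HasMatrix T Y) : HasMatrix (S - T) (X - Y) := fun i j =>
  congrArg₂ (· - ·) (hS i j) (hT i j)

theorem smul (c : ℂ) (hT : HasMatrix T X) : HasMatrix (c • T) (c • X) := fun i j =>
  congrArg (c • ·) (hT i j)

theorem submatrix {T : ℓ²(ι, ℂ) →L[ℂ] ℓ²(ι, ℂ)} {X : Matrix ι ι ℂ} (hT : HasMatrix T X)
    {f : κ → ι} (hf : Function.Injective f) : ∃ S, HasMatrix S (X.submatrix f f) := by
  obtain ⟨P, hP⟩ := exists_clm_apply_eq_comp hf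
  refine ⟨P ∘L T ∘L P.adjoint, fun i j => ?_⟩
  have hadj : P.adjoint (ket κ j) = ket ι (f j) := by
    refine ext_inner_left ℂ fun v => ?_
    rw [ContinuousLinearMap.adjoint_inner_right, inner_ket_right, inner_ket_right, hP]
  simp only [ContinuousLinearMap.comp_apply, hadj, hP]
  exact hT _ _

theorem one_kronecker [DecidableEq α] (hT : HasMatrix T X) :
    ∃ S, HasMatrix S ((1 : Matrix α α ℂ) ⊗ₖ X) := by
  choose slice hslice using fun a : α =>
    exists_clm_apply_eq_comp (Prod.mk_right_injective (α := α) (β := κ) a)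
  have hbound (v : ℓ²(α × κ, ℂ)) :
      ∑' p : α × ι, ‖T (slice p.1 v) p.2‖ₑ ^ 2 ≤ (‖T‖₊ * ‖v‖ₑ) ^ 2 := calc
    _ = ∑' a, ‖T (slice a v)‖ₑ ^ 2 := by
      rw [ENNReal.tsum_prod (f := fun a i => ‖T (slice a v) i‖ₑ ^ 2)]
      simp only [tsum_enorm_sq]
    _ ≤ ∑' a, (‖T‖₊ * ‖slice a v‖ₑ) ^ 2 := by
      gcongr with a
      exact T.le_opENorm (slice a v)
    _ = (‖T‖₊ * ‖v‖ₑ) ^ 2 := by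
      simp only [mul_pow, ENNReal.tsum_mul_left]
      rw [← tsum_enorm_sq v, ENNReal.tsum_prod (f := fun a k => ‖v (a, k)‖ₑ ^ 2)]
      simp only [← tsum_enorm_sq, hslice]
  obtain ⟨S, hS⟩ := exists_clm_of_tsum_enorm_sq_le (fun p : α × ι =>
    (lp.evalCLM ℂ (fun _ : ι => ℂ) 2 p.2 ∘L T ∘L slice p.1).toLinearMap) ‖T‖₊ hbound
  refine ⟨S, fun ⟨a, i⟩ ⟨b, j⟩ => (hS _ _).trans ?_⟩
  classical
  have hket : slice a (ket (α × κ) (b, j)) = (1 : Matrix α α ℂ) a b • ket κ j := by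
    ext k
    rcases eq_or_ne a b with rfl | hab <;> simp [ket_apply, *]
  calc T (slice a (ket (α × κ) (b, j))) i = (1 : Matrix α α ℂ) a b * T (ket κ j) i := by
        rw [hket, map_smul, lp.coeFn_smul, Pi.smul_apply, smul_eq_mul]
    _ = ((1 : Matrix α α ℂ) ⊗ₖ X) (a, i) (b, j) := by rw [hT, kroneckerMap_apply]

theorem toOp_eq {T : ℓ²(ι, ℂ) →L[ℂ] ℓ²(ι, ℂ)} {X : Matrix ι ι ℂ} (hT : HasMatrix T X) :
    toOp X = T := by
  classical
  have h : ∃ T : ℓ²(ι, ℂ) →L[ℂ] ℓ²(ι, ℂ), ∀ i j, T (lp.single 2 j (1 : ℂ)) i = X i j :=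
    ⟨T, hT⟩
  have hX : HasMatrix (toOp X) X := by
    rw [toOp, dif_pos h]
    exact h.choose_spec
  exact hX.unique hT

theorem nonneg {T : ℓ²(ι, ℂ) →L[ℂ] ℓ²(ι, ℂ)} {X : Matrix ι ι ℂ} (hT : HasMatrix T X)
    (hX : X.PosSemidef) : 0 ≤ T := by
  have hfin (x : ι →₀ ℂ) :
      0 ≤ ⟪Finsupp.linearCombination ℂ (ket ι) x, T (Finsupp.linearCombination ℂ (ket ι) x)⟫_ℂ := by
    convert hX.2 x using 1
    simp only [Finsupp.linearCombination_apply, Finsupp.sum, map_sum, map_smul, sum_inner,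
      inner_sum, inner_smul_left, inner_smul_right, inner_ket_left, hT _ _, ← Complex.star_def]
    rw [Finset.sum_comm]
    simp only [← Finset.sum_mul, mul_comm (x _)]
  have hall (v : ℓ²(ι, ℂ)) : 0 ≤ ⟪v, T v⟫_ℂ := by
    have hclosed : IsClosed {v | 0 ≤ ⟪v, T v⟫_ℂ} :=
      isClosed_le continuous_const (continuous_id.inner T.continuous)
    have hspan : (Submodule.span ℂ (Set.range (ket ι)) : Set ℓ²(ι, ℂ)) ⊆ {v | 0 ≤ ⟪v, T v⟫_ℂ} := by
      rw [← Finsupp.range_linearCombination]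
      rintro _ ⟨x, rfl⟩
      exact hfin x
    have hdense := Submodule.dense_iff_topologicalClosure_eq_top.2 (ket ι).dense_span
    exact hclosed.closure_subset_iff.2 hspan (hdense v)
  rw [ContinuousLinearMap.nonneg_iff_isPositive, ContinuousLinearMap.isPositive_iff_complex]
  intro v
  have hv := (IsSelfAdjoint.of_nonneg (hall v)).star_eq
  rw [Complex.star_def, inner_conj_symm] at hv
  rw [hv]
  have hre := Complex.nonneg_iff.1 (hall v)
  exact ⟨Complex.ext rfl hre.2, hre.1⟩

end HasMatrix

theorem hasMatrix_rankOne (v : ℓ²(ι, ℂ)) (w : ℓ²(κ, ℂ)) :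
    HasMatrix (InnerProductSpace.rankOne ℂ v w) (vecMulVec v (star w)) := fun i j => by
  rw [InnerProductSpace.rankOne_apply, inner_ket_right, lp.coeFn_smul, Pi.smul_apply, smul_eq_mul,
    vecMulVec_apply, mul_comm, Pi.star_apply]

theorem exists_hasMatrix_of_tsum_enorm_sq_ne_top {X : Matrix ι κ ℂ}
    (h : ∑' i, ∑' j, ‖X i j‖ₑ ^ 2 ≠ ⊤) : ∃ T, HasMatrix T X := by
  classical
  have hrow (i : ι) : Memℓp (fun j => star (X i j)) 2 :=
    memℓp_two_of_tsum_enorm_sq_ne_top (by simpa using ENNReal.ne_top_of_tsum_ne_top h i)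
  let row (i : ι) : ℓ²(κ, ℂ) := ⟨fun j => star (X i j), hrow i⟩
  have hrow_norm (i : ι) : ‖row i‖ₑ ^ 2 = ∑' j, ‖X i j‖ₑ ^ 2 := by
    simp [← tsum_enorm_sq, row]
  obtain ⟨C, hC⟩ : ∃ C : NNReal, ∑' i, ‖row i‖ₑ ^ 2 = C ^ 2 := by
    simp only [hrow_norm]
    lift ∑' i, ∑' j, ‖X i j‖ₑ ^ 2 to NNReal using h with c
    exact ⟨NNReal.sqrt c, by rw [← ENNReal.coe_pow, NNReal.sq_sqrt]⟩
  obtain ⟨T, hT⟩ := exists_clm_of_tsum_enorm_sq_le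
    (fun i => (innerSL ℂ (row i)).toLinearMap) C fun v => calc
      ∑' i, ‖⟪row i, v⟫_ℂ‖ₑ ^ 2 ≤ ∑' i, (‖row i‖ₑ * ‖v‖ₑ) ^ 2 := by
        gcongr with i
        simpa [enorm_eq_nnnorm, ← ENNReal.coe_mul, ← NNReal.coe_le_coe]
          using norm_inner_le_norm (row i) v
      _ = (C * ‖v‖ₑ) ^ 2 := by simp only [mul_pow, ENNReal.tsum_mul_right, hC]
  refine ⟨T, fun i j => (hT _ i).trans ?_⟩
  exact (inner_ket_right j (row i)).trans (star_star _)

theorem exists_hasMatrix_of_mem_traceClass {X : Matrix ι ι ℂ} (hX : X ∈ TraceClass ι) :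
    ∃ T, HasMatrix T X := by
  unfold TraceClass at hX
  induction hX using Submodule.span_induction with
  | mem X h =>
    refine exists_hasMatrix_of_tsum_enorm_sq_ne_top (ne_top_of_le_ne_top ?_ (calc
      ∑' i, ∑' j, ‖X i j‖ₑ ^ 2 ≤ ∑' i, ∑' j, ‖X i i‖ₑ * ‖X j j‖ₑ := by
        gcongr with i j
        simpa [enorm_eq_nnnorm, ← ENNReal.coe_mul, ← ENNReal.coe_pow, ← NNReal.coe_le_coe]
          using norm_entry_sq_le h.1 i j
      _ = (∑' i, ‖X i i‖ₑ) * ∑' j, ‖X j j‖ₑ := by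
        simp only [ENNReal.tsum_mul_left, ENNReal.tsum_mul_right]))
    have := tsum_enorm_ne_top_iff_summable_norm.2 h.2.norm
    finiteness
  | zero => exact ⟨0, fun _ _ => rfl⟩
  | add X Y _ _ hX hY =>
    obtain ⟨S, hS⟩ := hX
    obtain ⟨T, hT⟩ := hY
    exact ⟨S + T, hS.add hT⟩
  | smul c X _ hX =>
    obtain ⟨T, hT⟩ := hX
    exact ⟨c • T, hT.smul c⟩

theorem hasMatrix_toOp {X : Matrix ι ι ℂ} (hX : ∃ T, HasMatrix T X) : HasMatrix (toOp X) X := by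
  obtain ⟨T, hT⟩ := hX
  rwa [hT.toOp_eq]

theorem summable_diag {X : Matrix ι ι ℂ} (hX : X ∈ TraceClass ι) : Summable fun i => X i i := by
  unfold TraceClass at hX
  induction hX using Submodule.span_induction with
  | mem X h => exact h.2
  | zero => exact summable_zero
  | add X Y _ _ hX hY => exact hX.add hY
  | smul c X _ hX => exact hX.mul_left c

end Matrices

/-! ### The trace of a product -/

section Trace

variable {ι κ E F : Type*} [NormedAddCommGroup E] [InnerProductSpace ℂ E]
  [NormedAddCommGroup F] [InnerProductSpace ℂ F]

theorem hasSum_norm_inner_sq (b : HilbertBasis ι ℂ E) (x : E) :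
    HasSum (fun i => ‖⟪x, b i⟫_ℂ‖ ^ 2) (‖x‖ ^ 2) := by
  simpa [b.repr_apply_apply, norm_inner_symm] using lp.hasSum_norm (p := 2) (by simp) (b.repr x)

theorem summable_norm_inner_sq (c : HilbertBasis κ ℂ F) {u : ι → F}
    (hu : Summable fun i => ‖u i‖ ^ 2) : Summable fun p : ι × κ => ‖⟪u p.1, c p.2⟫_ℂ‖ ^ 2 := by
  rw [summable_prod_of_nonneg fun p => by positivity]
  refine ⟨fun i => (hasSum_norm_inner_sq c (u i)).summable, ?_⟩
  simpa only [(hasSum_norm_inner_sq c _).tsum_eq] using hu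

variable [CompleteSpace E] [CompleteSpace F]

theorem exists_hasSum_inner_hasSum_inner_adjoint (b : HilbertBasis ι ℂ E)
    (c : HilbertBasis κ ℂ F) {S T : E →L[ℂ] F} (hS : Summable fun i => ‖S (b i)‖ ^ 2)
    (hT : Summable fun i => ‖T (b i)‖ ^ 2) :
    ∃ r : ℂ, HasSum (fun i => ⟪S (b i), T (b i)⟫_ℂ) r ∧
      HasSum (fun k => ⟪T.adjoint (c k), S.adjoint (c k)⟫_ℂ) r := by
  let f (p : ι × κ) : ℂ := ⟪S (b p.1), c p.2⟫_ℂ * ⟪c p.2, T (b p.1)⟫_ℂ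
  have hf : Summable f := by
    refine .of_norm_bounded ((summable_norm_inner_sq c hS).add (summable_norm_inner_sq c hT))
      fun p => ?_
    rw [norm_mul, norm_inner_symm (c p.2)]
    nlinarith [sq_nonneg (‖⟪S (b p.1), c p.2⟫_ℂ‖ - ‖⟪T (b p.1), c p.2⟫_ℂ‖)]
  have hrow (i : ι) : HasSum (fun k => f (i, k)) ⟪S (b i), T (b i)⟫_ℂ :=
    c.hasSum_inner_mul_inner (S (b i)) (T (b i))
  have hcol (k : κ) : HasSum (fun i => f (i, k)) ⟪T.adjoint (c k), S.adjoint (c k)⟫_ℂ := by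
    have h := b.hasSum_inner_mul_inner (T.adjoint (c k)) (S.adjoint (c k))
    simpa only [f, ContinuousLinearMap.adjoint_inner_left, ContinuousLinearMap.adjoint_inner_right,
      mul_comm] using h
  have hswap : HasSum (f ∘ Prod.swap) (∑' p, f p) :=
    (Equiv.prodComm κ ι).hasSum_iff.2 hf.hasSum
  exact ⟨∑' p, f p, hf.hasSum.prod_fiberwise hrow, hswap.prod_fiberwise hcol⟩

theorem exists_nonneg_hasSum_inner_mul (b : HilbertBasis ι ℂ E) {P S : E →L[ℂ] E} (hP : 0 ≤ P)
    (hS : 0 ≤ S) (hsum : Summable fun i => ⟪b i, P (b i)⟫_ℂ) :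
    ∃ r : ℂ, 0 ≤ r ∧ HasSum (fun i => ⟪b i, P (S (b i))⟫_ℂ) r := by
  let Q := CFC.sqrt P
  have hQ (x y : E) : ⟪Q x, y⟫_ℂ = ⟪x, Q y⟫_ℂ :=
    ((ContinuousLinearMap.nonneg_iff_isPositive _).1
      (CFC.sqrt_nonneg P)).inner_left_eq_inner_right x y
  have hQadj : Q.adjoint = Q := (CFC.sqrt_nonneg P).isSelfAdjoint
  have hSpos := (ContinuousLinearMap.nonneg_iff_isPositive _).1 hS
  have hSadj : S.adjoint = S := hS.isSelfAdjoint
  have hQQ (x : E) : Q (Q x) = P x := DFunLike.congr_fun (CFC.sqrt_mul_sqrt_self P) x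
  have hQsum : Summable fun i => ‖Q (b i)‖ ^ 2 := by
    refine hsum.norm.congr fun i => ?_
    rw [← hQQ, ← hQ, inner_self_eq_norm_sq_to_K, norm_pow]
    simp
  have hSQsum : Summable fun i => ‖S (Q (b i))‖ ^ 2 := by
    refine (hQsum.mul_left (‖S‖ ^ 2)).of_nonneg_of_le (fun i => by positivity) fun i => ?_
    rw [← mul_pow]
    gcongr
    exact S.le_opNorm _
  obtain ⟨r, hr, hr'⟩ := exists_hasSum_inner_hasSum_inner_adjoint b b (S := S ∘L Q) hSQsum hQsum
  refine ⟨r, hr.nonneg fun i => hSpos.inner_nonneg_left _, ?_⟩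
  simpa only [ContinuousLinearMap.adjoint_comp, hQadj, hSadj, ContinuousLinearMap.comp_apply, hQ,
    hQQ] using hr'

end Trace

/-! ### Operator inequalities for the logarithm -/

section Log

variable {𝒜 : Type*} [CStarAlgebra 𝒜] [PartialOrder 𝒜] [StarOrderedRing 𝒜]

theorem isStrictlyPositive_add_smul_one {P : 𝒜} (hP : 0 ≤ P) {ε : ℝ} (hε : 0 < ε) :
    IsStrictlyPositive (P + ε • (1 : 𝒜)) := by
  have hε1 : IsStrictlyPositive (ε • (1 : 𝒜)) := IsStrictlyPositive.smul hε isStrictlyPositive_one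
  exact hε1.of_le (le_add_of_nonneg_left hP)

theorem log_sub_log_le {P Q : 𝒜} (hP : 0 ≤ P) (hQ : 0 ≤ Q) {d ε : ℝ} (hd : 1 ≤ d) (hε : 0 < ε)
    (h : P ≤ d • Q) :
    CFC.log (P + ε • (1 : 𝒜)) - CFC.log (Q + ε • (1 : 𝒜)) ≤ Real.log d • (1 : 𝒜) := by
  have hshift : P + ε • (1 : 𝒜) ≤ d • (Q + ε • (1 : 𝒜)) := by
    rw [smul_add, smul_smul]
    refine add_le_add h (smul_le_smul_of_nonneg_right ?_ zero_le_one)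
    nlinarith
  have hlog := CFC.log_le_log hshift (isStrictlyPositive_add_smul_one hP hε)
  rw [CFC.log_smul' _ (by linarith) (isStrictlyPositive_add_smul_one hQ hε),
    Algebra.algebraMap_eq_smul_one] at hlog
  rwa [sub_le_iff_le_add]

theorem log_le_tangent {Q : 𝒜} (hQ : IsStrictlyPositive Q) {c : ℝ} (hc : 0 < c) :
    CFC.log Q ≤ (Real.log c - 1) • (1 : 𝒜) + c⁻¹ • Q := by
  have hsa : IsSelfAdjoint Q := hQ.isSelfAdjoint
  have htangent : (Real.log c - 1) • (1 : 𝒜) + c⁻¹ • Q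
      = cfc (fun x : ℝ => (Real.log c - 1) + c⁻¹ * x) Q := by
    rw [cfc_const_add .., cfc_const_mul_id .., Algebra.algebraMap_eq_smul_one]
  have hpos : ∀ x ∈ spectrum ℝ Q, 0 < x := fun x hx => hQ.spectrum_pos hx
  rw [htangent, CFC.log]
  refine cfc_mono (fun x hx => ?_)
    (Real.continuousOn_log.mono fun x hx => by simpa using (hpos x hx).ne') (by fun_prop)
  have hx0 := hpos x hx
  have hlog := Real.log_le_sub_one_of_pos (x := c⁻¹ * x) (by positivity)
  rw [Real.log_mul (by positivity) hx0.ne', Real.log_inv] at hlog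
  linarith

theorem chord_le_log {P : 𝒜} (hP : 0 ≤ P) (hP1 : P ≤ 1) {ε : ℝ} (hε : 0 < ε) :
    Real.log ε • (1 : 𝒜) + (Real.log (1 + ε) - Real.log ε) • P ≤ CFC.log (P + ε • (1 : 𝒜)) := by
  have hsa : IsSelfAdjoint P := hP.isSelfAdjoint
  have hchord : Real.log ε • (1 : 𝒜) + (Real.log (1 + ε) - Real.log ε) • P
      = cfc (fun x : ℝ => Real.log ε + (Real.log (1 + ε) - Real.log ε) * x) P := by
    rw [cfc_const_add .., cfc_const_mul_id .., Algebra.algebraMap_eq_smul_one]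
  have hshift : P + ε • (1 : 𝒜) = cfc (fun x : ℝ => x + ε) P := by
    rw [cfc_add_const .., cfc_id' .., Algebra.algebraMap_eq_smul_one]
  have hpos : ∀ x ∈ spectrum ℝ P, 0 ≤ x := fun x hx => spectrum_nonneg_of_nonneg hP hx
  have hle : ∀ x ∈ spectrum ℝ P, x ≤ 1 := by
    have : P ≤ algebraMap ℝ 𝒜 1 := by simpa using hP1
    exact (le_algebraMap_iff_spectrum_le).1 this
  have hcont : ContinuousOn (fun x : ℝ => Real.log (x + ε)) (spectrum ℝ P) :=
    ContinuousOn.log (by fun_prop) fun x hx =>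
      (add_pos_of_nonneg_of_pos (hpos x hx) hε).ne'
  have hlog : CFC.log (P + ε • (1 : 𝒜)) = cfc (fun x : ℝ => Real.log (x + ε)) P := by
    rw [hshift, CFC.log, ← cfc_comp' Real.log (fun x : ℝ => x + ε) P ?_]
    refine Real.continuousOn_log.mono ?_
    rintro _ ⟨x, hx, rfl⟩
    exact (add_pos_of_nonneg_of_pos (hpos x hx) hε).ne'
  rw [hchord, hlog]
  refine cfc_mono (fun x hx => ?_) (by fun_prop) hcont
  have hε1 : 0 < 1 + ε := by positivity
  have hconcave := strictConcaveOn_log_Ioi.concaveOn.2 (Set.mem_Ioi.2 hε) (Set.mem_Ioi.2 hε1)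
    (sub_nonneg.2 (hle x hx)) (hpos x hx) (by ring)
  have hpoint : (1 - x) * ε + x * (1 + ε) = x + ε := by ring
  simp only [smul_eq_mul, hpoint] at hconcave
  linarith

end Log

/-! ### Bounds on the relative entropy -/

section RelEntropy

variable {ι : Type*} {ρ σ : Matrix ι ι ℂ}

theorem regRelEntropy_eq {S T : ℓ²(ι, ℂ) →L[ℂ] ℓ²(ι, ℂ)} (hS : HasMatrix S ρ)
    (hT : HasMatrix T σ) (ε : ℝ) :
    regRelEntropy ρ σ ε =
      (∑' i, (⟪ket ι i, S ((CFC.log (S + ε • 1) - CFC.log (T + ε • 1)) (ket ι i))⟫_ℂ).re) /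
        Real.log 2 := by
  simp only [inner_ket_left, ← hS.toOp_eq, ← hT.toOp_eq]
  rfl

/-- A density operator, given by its matrix; this is `IsState` for matrices that are not presented
as elements of `TraceClass`. -/
def IsDensityMatrix (ρ : Matrix ι ι ℂ) : Prop := ρ.PosSemidef ∧ HasSum (fun i => ρ i i) 1

theorem isState_iff_isDensityMatrix (ρ : TraceClass ι) : IsState ρ ↔ IsDensityMatrix ρ.1 :=
  and_congr_right fun _ => ((summable_diag ρ.2).hasSum_iff).symm

namespace IsDensityMatrix

theorem mem_traceClass (hρ : IsDensityMatrix ρ) : ρ ∈ TraceClass ι :=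
  Submodule.subset_span ⟨hρ.1, hρ.2.summable⟩

theorem tsum_re_inner_mul_le (hρ : IsDensityMatrix ρ) {S T : ℓ²(ι, ℂ) →L[ℂ] ℓ²(ι, ℂ)}
    (hS : HasMatrix S ρ) {c : ℝ} (hT : T ≤ c • 1) :
    ∑' i, (⟪ket ι i, S (T (ket ι i))⟫_ℂ).re ≤ c := by
  have hdiag : HasSum (fun i => ⟪ket ι i, S (ket ι i)⟫_ℂ) 1 := by
    simpa only [inner_ket_left, hS _ _] using hρ.2
  obtain ⟨r, hr, hsum⟩ := exists_nonneg_hasSum_inner_mul (ket ι) (hS.nonneg hρ.1)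
    (sub_nonneg.2 hT) hdiag.summable
  have hsum' : HasSum (fun i => ⟪ket ι i, S (T (ket ι i))⟫_ℂ) (c • 1 - r) := by
    simpa only [_root_.sub_apply, _root_.smul_apply, one_apply_eq_self, map_sub,
      ContinuousLinearMap.map_smul_of_tower, inner_sub_right, inner_smul_right_eq_smul,
      sub_sub_cancel] using (hdiag.const_smul c).sub hsum
  rw [(Complex.hasSum_re hsum').tsum_eq]
  simpa using (Complex.nonneg_iff.1 hr).1

theorem relEntropy_le_logb (hρ : IsDensityMatrix ρ) (hσ : σ.PosSemidef)
    (hσT : ∃ T, HasMatrix T σ) {d : ℝ} (hd : 1 ≤ d) (h : ((d : ℂ) • σ - ρ).PosSemidef) :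
    relEntropy ρ σ ≤ (Real.logb 2 d : ℝ) := by
  obtain ⟨S, hS⟩ := exists_hasMatrix_of_mem_traceClass hρ.mem_traceClass
  obtain ⟨T, hT⟩ := hσT
  have hle : S ≤ d • T := sub_nonneg.1 (((hT.smul d).sub hS).nonneg h)
  refine Filter.limsup_le_of_le (by isBoundedDefault) ?_
  filter_upwards [self_mem_nhdsWithin] with ε hε
  rw [EReal.coe_le_coe_iff, regRelEntropy_eq hS hT, Real.logb]
  gcongr
  exact hρ.tsum_re_inner_mul_le hS (log_sub_log_le (hS.nonneg hρ.1) (hT.nonneg hσ) hd hε hle)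

end IsDensityMatrix

end RelEntropy

/-! ### The relative entropy of a pure state -/

section PureState

variable {E : Type*} [NormedAddCommGroup E] [InnerProductSpace ℂ E]

theorem re_inner_le_re_inner {S T : E →L[ℂ] E} (h : S ≤ T) (x : E) :
    (⟪x, S x⟫_ℂ).re ≤ (⟪x, T x⟫_ℂ).re := by
  have hpos := ((ContinuousLinearMap.le_def S T).1 h).inner_nonneg_right x
  rw [_root_.sub_apply, inner_sub_right] at hpos
  exact Complex.re_le_re (sub_nonneg.1 hpos)

variable [CompleteSpace E] {φ : E}

theorem re_inner_log_add_le_log (hφ : ‖φ‖ = 1) {T : E →L[ℂ] E} (hT : 0 ≤ T) {t ε : ℝ}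
    (ht : 0 ≤ t) (hε : 0 < ε) (hφT : (⟪φ, T φ⟫_ℂ).re ≤ t) :
    (⟪φ, CFC.log (T + ε • (1 : E →L[ℂ] E)) φ⟫_ℂ).re ≤ Real.log (t + ε) := by
  have hc : 0 < t + ε := by positivity
  calc (⟪φ, CFC.log (T + ε • (1 : E →L[ℂ] E)) φ⟫_ℂ).re
      ≤ (⟪φ, ((Real.log (t + ε) - 1) • (1 : E →L[ℂ] E) +
          (t + ε)⁻¹ • (T + ε • (1 : E →L[ℂ] E))) φ⟫_ℂ).re :=
        re_inner_le_re_inner (log_le_tangent (isStrictlyPositive_add_smul_one hT hε) hc) φ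
    _ = Real.log (t + ε) - 1 + (t + ε)⁻¹ * ((⟪φ, T φ⟫_ℂ).re + ε) := by
        generalize (t + ε)⁻¹ = d
        simp [inner_smul_right_eq_smul, hφ, mul_add]
    _ ≤ Real.log (t + ε) - 1 + (t + ε)⁻¹ * (t + ε) := by gcongr
    _ = Real.log (t + ε) := by rw [inv_mul_cancel₀ hc.ne', sub_add_cancel]

theorem log_one_add_le_re_inner_log_rankOne (hφ : ‖φ‖ = 1) {ε : ℝ} (hε : 0 < ε) :
    Real.log (1 + ε) ≤
      (⟪φ, CFC.log (InnerProductSpace.rankOne ℂ φ φ + ε • (1 : E →L[ℂ] E)) φ⟫_ℂ).re := by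
  have hP : IsStarProjection (InnerProductSpace.rankOne ℂ φ φ) :=
    InnerProductSpace.isStarProjection_rankOne_self hφ
  calc Real.log (1 + ε)
      = (⟪φ, (Real.log ε • (1 : E →L[ℂ] E) + (Real.log (1 + ε) - Real.log ε) •
          InnerProductSpace.rankOne ℂ φ φ) φ⟫_ℂ).re := by
        simp [inner_smul_right_eq_smul, hφ]
    _ ≤ _ := re_inner_le_re_inner (chord_le_log hP.nonneg hP.le_one hε) φ

theorem hasSum_inner_rankOne_apply {ι : Type*} (b : HilbertBasis ι ℂ E) (x : E) (T : E →L[ℂ] E) :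
    HasSum (fun i => ⟪b i, InnerProductSpace.rankOne ℂ x x (T (b i))⟫_ℂ) ⟪x, T x⟫_ℂ := by
  rw [← ContinuousLinearMap.adjoint_inner_left]
  simpa only [InnerProductSpace.rankOne_apply, inner_smul_right,
    ContinuousLinearMap.adjoint_inner_left] using b.hasSum_inner_mul_inner (T.adjoint x) x

end PureState

section PureStateMatrix

variable {ι : Type*} {φ : ℓ²(ι, ℂ)} {σ : Matrix ι ι ℂ} {T : ℓ²(ι, ℂ) →L[ℂ] ℓ²(ι, ℂ)} {t : ℝ}

theorem logb_sub_logb_le_regRelEntropy (hφ : ‖φ‖ = 1) (hσ : σ.PosSemidef) (hT : HasMatrix T σ)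
    (ht : 0 < t) (hφT : (⟪φ, T φ⟫_ℂ).re ≤ t) {ε : ℝ} (hε : 0 < ε) :
    Real.logb 2 (1 + ε) - Real.logb 2 (t + ε) ≤ regRelEntropy (vecMulVec φ (star φ)) σ ε := by
  rw [regRelEntropy_eq (hasMatrix_rankOne φ φ) hT, Real.logb, Real.logb, ← sub_div,
    (Complex.hasSum_re (hasSum_inner_rankOne_apply (ket ι) φ _)).tsum_eq, _root_.sub_apply,
    inner_sub_right, Complex.sub_re]
  gcongr
  · exact log_one_add_le_re_inner_log_rankOne hφ hε
  · exact re_inner_log_add_le_log hφ (hT.nonneg hσ) ht.le hε hφT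

theorem logb_inv_le_relEntropy (hφ : ‖φ‖ = 1) (hσ : σ.PosSemidef) (hT : HasMatrix T σ)
    (ht : 0 < t) (hφT : (⟪φ, T φ⟫_ℂ).re ≤ t) :
    (Real.logb 2 t⁻¹ : ℝ) ≤ relEntropy (vecMulVec φ (star φ)) σ := by
  have hcont : ContinuousAt (fun ε : ℝ => Real.logb 2 (1 + ε) - Real.logb 2 (t + ε)) 0 := by
    refine .sub (.logb (by fun_prop) (by simp)) (.logb (by fun_prop) (by simpa using ht.ne'))
  have hlim : Filter.Tendsto
      (fun ε : ℝ => ((Real.logb 2 (1 + ε) - Real.logb 2 (t + ε) : ℝ) : EReal)) (𝓝[>] 0)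
      (𝓝 (Real.logb 2 t⁻¹ : ℝ)) := by
    refine (continuous_coe_real_ereal.tendsto _).comp ?_
    simpa [Real.logb_inv] using hcont.tendsto.mono_left nhdsWithin_le_nhds
  rw [← hlim.limsup_eq]
  refine Filter.limsup_le_limsup ?_
  filter_upwards [self_mem_nhdsWithin] with ε hε
  exact EReal.coe_le_coe_iff.2 (logb_sub_logb_le_regRelEntropy hφ hσ hT ht hφT hε)

end PureStateMatrix

/-! ### Amplified channels and partial traces -/

section Amplification

variable {R ι κ : Type*}

theorem hasSum_tr (X : TraceClass ι) : HasSum (fun i => X.1 i i) (tr X) :=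
  (summable_diag X.2).hasSum

theorem submatrix_mem_traceClass {X : Matrix ι ι ℂ} (hX : X ∈ TraceClass ι) {f : κ → ι}
    (hf : Function.Injective f) : X.submatrix f f ∈ TraceClass κ := by
  unfold TraceClass at hX
  induction hX using Submodule.span_induction with
  | mem X h => exact Submodule.subset_span ⟨h.1.submatrix f, h.2.comp_injective hf⟩
  | zero => exact (TraceClass κ).zero_mem
  | add X Y _ _ hX hY => exact (TraceClass κ).add_mem hX hY
  | smul c X _ hX => exact (TraceClass κ).smul_mem c hX

theorem posSemidef_amplify {Φ : TraceClass ι →ₗ[ℂ] Matrix κ κ ℂ} (hΦ : IsCompletelyPositive Φ)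
    {X : TraceClass (R × ι)} (hX : X.1.PosSemidef) : (amplify Φ X).PosSemidef := by
  classical
  refine posSemidef_of_forall_finset fun s => ?_
  let t : Finset R := s.image Prod.fst
  let f : Fin t.card → R := fun k => t.equivFin.symm k
  have hf : Function.Injective f := Subtype.val_injective.comp t.equivFin.symm.injective
  have hfin : ((amplify Φ X).submatrix (Prod.map f id) (Prod.map f id)).PosSemidef :=
    hΦ t.card ⟨_, submatrix_mem_traceClass X.2 (hf.prodMap Function.injective_id)⟩
      (hX.submatrix _)
  let g : s → Fin t.card × κ := fun p =>
    (t.equivFin ⟨p.1.1, Finset.mem_image_of_mem Prod.fst p.2⟩, p.1.2)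
  have hfg : Prod.map f id ∘ g = ((↑) : s → R × κ) := by
    ext p <;> simp [f, g]
  simpa only [submatrix_submatrix, hfg] using hfin.submatrix g

theorem hasSum_prod_of_nonneg {f : ι × κ → ℂ} (hf : 0 ≤ f) {g : ι → ℂ}
    (hg : ∀ i, HasSum (fun k => f (i, k)) (g i)) {a : ℂ} (ha : HasSum g a) : HasSum f a := by
  have hnorm (p : ι × κ) : ‖f p‖ = (f p).re := (Complex.re_eq_norm.2 (hf p)).symm
  have hs : Summable f := by
    refine .of_norm ((summable_prod_of_nonneg fun p => norm_nonneg _).2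
      ⟨fun i => (hg i).summable.norm, ?_⟩)
    simpa only [hnorm, (Complex.hasSum_re (hg _)).tsum_eq] using (Complex.hasSum_re ha).summable
  exact ha.unique (hs.hasSum.prod_fiberwise hg) ▸ hs.hasSum

theorem hasSum_diag_amplify (N : Channel ι κ) {X : TraceClass (R × ι)} (hX : X.1.PosSemidef) :
    HasSum (fun p => amplify N.toOperators X p p) (tr X) := by
  refine hasSum_prod_of_nonneg
    (fun p => (posSemidef_amplify N.completelyPositive hX).diag_nonneg) (fun r => ?_)
    ((hasSum_tr X).prod_fiberwise fun r => hasSum_tr (block r r X))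
  rw [← N.trace_preserving]
  exact hasSum_tr (N.map (block r r X))

theorem isDensityMatrix_amplify (N : Channel ι κ) {ρ : TraceClass (R × ι)} (hρ : IsState ρ) :
    IsDensityMatrix (amplify N.toOperators ρ) :=
  ⟨posSemidef_amplify N.completelyPositive hρ.1, hρ.2 ▸ hasSum_diag_amplify N hρ.1⟩

theorem hasSum_blockMatrix (X : TraceClass (ι × κ)) :
    HasSum (fun i => blockMatrix i i X.1) (partialTrace ι κ X).1 :=
  Pi.hasSum.2 fun k => Pi.hasSum.2 fun l => (summable_fiber X.2 k l).hasSum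

theorem tr_partialTrace (X : TraceClass (ι × κ)) : tr (partialTrace ι κ X) = tr X :=
  (((Equiv.prodComm κ ι).hasSum_iff.2 (hasSum_tr X)).prod_fiberwise fun k =>
    (summable_fiber X.2 k k).hasSum).tsum_eq

theorem isState_partialTrace {ρ : TraceClass (ι × κ)} (hρ : IsState ρ) :
    IsState (partialTrace ι κ ρ) :=
  ⟨posSemidef_of_hasSum (hasSum_blockMatrix ρ) fun _ => hρ.1.submatrix _,
    (tr_partialTrace ρ).trans hρ.2⟩

/-- The canonical identification of `R ⊗ (ι ⊗ κ)` with `ι ⊗ (R ⊗ κ)`, on the level of index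
sets. -/
def prodLeftComm (R ι κ : Type*) : R × (ι × κ) ≃ ι × (R × κ) where
  toFun p := (p.2.1, (p.1, p.2.2))
  invFun p := (p.2.1, (p.1, p.2.2))

/-- The partial trace of an operator on `R ⊗ (ι ⊗ κ)` over the middle factor `ι`. -/
def middleTrace (X : TraceClass (R × (ι × κ))) : TraceClass (R × κ) :=
  partialTrace ι (R × κ) ⟨X.1.submatrix (prodLeftComm R ι κ).symm (prodLeftComm R ι κ).symm,
    submatrix_mem_traceClass X.2 (prodLeftComm R ι κ).symm.injective⟩

theorem block_middleTrace (X : TraceClass (R × (ι × κ))) (r s : R) :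
    block r s (middleTrace X) = partialTrace ι κ (block r s X) :=
  rfl

theorem isState_middleTrace {ρ : TraceClass (R × (ι × κ))} (hρ : IsState ρ) :
    IsState (middleTrace ρ) :=
  isState_partialTrace ⟨hρ.1.submatrix _,
    ((prodLeftComm R ι κ).symm.tsum_eq fun p => ρ.1 p p).trans hρ.2⟩

theorem amplify_mixingTensor {A' B' A B : Type*} [DecidableEq A] (M : Channel B' B)
    (X : TraceClass (R × (A' × B'))) :
    amplify (mixingTensor A M) X =
      ((1 : Matrix A A ℂ) ⊗ₖ amplify M.toOperators (middleTrace X)).submatrix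
        (prodLeftComm R A B) (prodLeftComm R A B) := by
  ext p q
  simp only [amplify, mixingTensor, of_apply, LinearMap.coe_mk, AddHom.coe_mk,
    ← block_middleTrace, submatrix_apply, kroneckerMap_apply, one_apply]
  congr!

end Amplification

/-! ### Semicausal channels -/

section Semicausal

variable {R A' B' A B : Type*} {N : Channel (A' × B') (A × B)}

theorem exists_hasMatrix_amplify_mixingTensor (A : Type*) (M : Channel B' B)
    {ρ : TraceClass (R × (A' × B'))} (hρ : IsState ρ) :
    ∃ T, HasMatrix T (amplify (mixingTensor A M) ρ) := by
  classical
  have hτ := (isDensityMatrix_amplify M (isState_middleTrace hρ)).mem_traceClass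
  obtain ⟨S, hS⟩ := exists_hasMatrix_of_mem_traceClass hτ
  obtain ⟨T, hT⟩ := hS.one_kronecker (α := A)
  rw [amplify_mixingTensor]
  exact hT.submatrix (prodLeftComm R A B).injective

theorem posSemidef_amplify_mixingTensor (A : Type*) (M : Channel B' B)
    {ρ : TraceClass (R × (A' × B'))} (hρ : IsState ρ) :
    (amplify (mixingTensor A M) ρ).PosSemidef := by
  classical
  rw [amplify_mixingTensor]
  exact (posSemidef_kronecker .one
    (isDensityMatrix_amplify M (isState_middleTrace hρ)).1).submatrix _

theorem amplify_middleTrace_eq_sum_blockMatrix [Fintype A] {M : Channel B' B}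
    (hM : ∀ X, partialTrace A B (N.map X) = M.map (partialTrace A' B' X))
    (X : TraceClass (R × (A' × B'))) :
    amplify M.toOperators (middleTrace X) =
      ∑ a, blockMatrix a a ((amplify N.toOperators X).submatrix
        (prodLeftComm R A B).symm (prodLeftComm R A B).symm) := by
  ext ⟨r, b⟩ ⟨s, b'⟩
  have hblock : (M.map (block r s (middleTrace X))).1 =
      ∑ a, blockMatrix a a (N.map (block r s X)).1 := by
    rw [block_middleTrace, ← hM]
    exact (hasSum_blockMatrix _).unique (hasSum_fintype _)
  change (M.map (block r s (middleTrace X))).1 b b' = _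
  rw [hblock, Matrix.sum_apply, Matrix.sum_apply]
  rfl

theorem posSemidef_card_smul_amplify_mixingTensor_sub [Fintype A] {M : Channel B' B}
    (hM : ∀ X, partialTrace A B (N.map X) = M.map (partialTrace A' B' X))
    {X : TraceClass (R × (A' × B'))} (hX : X.1.PosSemidef) :
    ((Fintype.card A : ℂ) • amplify (mixingTensor A M) X - amplify N.toOperators X).PosSemidef := by
  classical
  have hω : (amplify N.toOperators X).PosSemidef := posSemidef_amplify N.completelyPositive hX
  have h := (posSemidef_card_smul_kronecker_sum_block_sub
    (hω.submatrix (prodLeftComm R A B).symm)).submatrix (prodLeftComm R A B)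
  rw [← amplify_middleTrace_eq_sum_blockMatrix hM] at h
  rw [amplify_mixingTensor]
  simpa [submatrix_sub, submatrix_smul] using h

theorem channelRelEntropy_mixingTensor_le [Finite A] [Nonempty A] {M : Channel B' B}
    (hM : ∀ X, partialTrace A B (N.map X) = M.map (partialTrace A' B' X)) :
    channelRelEntropy N.toOperators (mixingTensor A M) ≤ (Real.logb 2 (Nat.card A) : ℝ) := by
  have := Fintype.ofFinite A
  refine iSup_le fun R => iSup_le fun _ => iSup_le fun ρ => iSup_le fun hρ => ?_
  refine (isDensityMatrix_amplify N hρ).relEntropy_le_logb (posSemidef_amplify_mixingTensor A M hρ)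
    (exists_hasMatrix_amplify_mixingTensor A M hρ) (by exact_mod_cast Nat.card_pos) ?_
  simpa using posSemidef_card_smul_amplify_mixingTensor_sub hM hρ.1

theorem neg_logDim_le_condEntropy [Nonempty A] (hN : IsSemicausal N) :
    -logDim A ≤ condEntropy N := by
  obtain ⟨M, hM⟩ := hN
  rw [condEntropy, EReal.neg_le_neg_iff, logDim]
  refine (iInf_le _ M).trans ?_
  split_ifs
  · exact channelRelEntropy_mixingTensor_le hM
  · exact le_top

end Semicausal

/-! ### Unitary channels -/

section Unitary

variable {R ι κ : Type*}

theorem IsUnitaryChannel.exists_map_eq_vecMulVec {N : Channel ι κ} (hN : IsUnitaryChannel N) :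
    ∃ U : ℓ²(ι, ℂ) ≃ₗᵢ[ℂ] ℓ²(κ, ℂ), ∀ (X : TraceClass ι) (v w : ℓ²(ι, ℂ)),
      X.1 = vecMulVec v (star w) → (N.map X).1 = vecMulVec (U v) (star (U w)) := by
  obtain ⟨U, hU⟩ := hN
  refine ⟨U, fun X v w hX => ?_⟩
  have hNX := hasMatrix_toOp (exists_hasMatrix_of_mem_traceClass (N.map X).2)
  have hop : toOp X.1 = InnerProductSpace.rankOne ℂ v w :=
    hX ▸ (hasMatrix_rankOne v w).toOp_eq
  ext i j
  rw [← hNX i j, hU, hop, InnerProductSpace.rankOne_apply, map_smul, ← U.inner_map_map,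
    U.apply_symm_apply, inner_ket_right, lp.coeFn_smul, Pi.smul_apply, smul_eq_mul, mul_comm]
  rfl

theorem isDensityMatrix_vecMulVec {u : R × ι → ℂ} {ψ : R → ℓ²(ι, ℂ)}
    (hu : ∀ r x, u (r, x) = ψ r x) (hψ : HasSum (fun r => ⟪ψ r, ψ r⟫_ℂ) 1) :
    IsDensityMatrix (vecMulVec u (star u)) := by
  have hpsd := posSemidef_vecMulVec_star u
  have hdiag (r : R) (x : ι) : vecMulVec u (star u) (r, x) (r, x) = ⟪ψ r x, ψ r x⟫_ℂ := by
    simp only [vecMulVec_apply, Pi.star_apply, hu, RCLike.inner_apply, Complex.star_def]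
  refine ⟨hpsd, hasSum_prod_of_nonneg (f := fun p => vecMulVec u (star u) p p)
    (fun _ => hpsd.diag_nonneg) (fun r => ?_) hψ⟩
  simpa only [hdiag] using lp.hasSum_inner (𝕜 := ℂ) (ψ r) (ψ r)

theorem IsUnitaryChannel.exists_amplify_eq_vecMulVec {N : Channel ι κ} (hN : IsUnitaryChannel N)
    {φ : ℓ²(R × κ, ℂ)} (hφ : ‖φ‖ = 1) :
    ∃ ρ : TraceClass (R × ι), IsState ρ ∧ amplify N.toOperators ρ = vecMulVec φ (star φ) := by
  obtain ⟨U, hU⟩ := hN.exists_map_eq_vecMulVec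
  choose slice hslice using fun r : R =>
    exists_clm_apply_eq_comp (Prod.mk_right_injective (α := R) (β := κ) r)
  have hslices : HasSum (fun r => ⟪slice r φ, slice r φ⟫_ℂ) 1 := by
    rw [← inner_self_eq_one_of_norm_eq_one (𝕜 := ℂ) hφ]
    refine (lp.hasSum_inner φ φ).prod_fiberwise fun r => ?_
    simpa only [hslice] using lp.hasSum_inner (𝕜 := ℂ) (slice r φ) (slice r φ)
  let u : R × ι → ℂ := fun p => U.symm (slice p.1 φ) p.2
  have hu : IsDensityMatrix (vecMulVec u (star u)) := by
    refine isDensityMatrix_vecMulVec (ψ := fun r => U.symm (slice r φ)) (fun _ _ => rfl) ?_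
    simpa only [LinearIsometryEquiv.inner_map_map] using hslices
  let ρ : TraceClass (R × ι) := ⟨vecMulVec u (star u), hu.mem_traceClass⟩
  refine ⟨ρ, (isState_iff_isDensityMatrix ρ).2 hu, ?_⟩
  ext ⟨r, x⟩ ⟨s, y⟩
  have hblock : (N.map (block r s ρ)).1 = vecMulVec (slice r φ) (star ⇑(slice s φ)) := by
    simpa only [U.apply_symm_apply] using
      hU (block r s ρ) (U.symm (slice r φ)) (U.symm (slice s φ)) rfl
  calc (N.map (block r s ρ)).1 x y = slice r φ x * star (slice s φ y) := by
        rw [hblock, vecMulVec_apply, Pi.star_apply]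
    _ = vecMulVec φ (star φ) (r, x) (s, y) := by
        rw [hslice, hslice, vecMulVec_apply, Pi.star_apply]

end Unitary

/-! ### Maximally entangled outputs -/

section MaximallyEntangled

variable {R κ : Type*} [Fintype R]

/-- The vector `|R|^(-1/2) ∑ k, |k⟩ ⊗ |g k⟩`; it is a maximally entangled unit vector when `g` is
injective. -/
def maxEntangled (g : R → κ) : ℓ²(R × κ, ℂ) :=
  (((√(Fintype.card R))⁻¹ : ℝ) : ℂ) • ∑ k, ket (R × κ) (k, g k)

theorem inner_maxEntangled_apply (g : R → κ) {T : ℓ²(R × κ, ℂ) →L[ℂ] ℓ²(R × κ, ℂ)}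
    {X : Matrix (R × κ) (R × κ) ℂ} (hT : HasMatrix T X) :
    ⟪maxEntangled g, T (maxEntangled g)⟫_ℂ =
      (Fintype.card R : ℂ)⁻¹ * ∑ l, ∑ k, X (k, g k) (l, g l) := by
  have hs : (((√(Fintype.card R))⁻¹ : ℝ) : ℂ) * ((√(Fintype.card R))⁻¹ : ℝ) =
      (Fintype.card R : ℂ)⁻¹ := by
    rw [← Complex.ofReal_mul, ← mul_inv, Real.mul_self_sqrt (Nat.cast_nonneg _)]
    simp
  simp only [maxEntangled, map_smul, map_sum, inner_smul_left, inner_smul_right, sum_inner,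
    inner_sum, inner_ket_left, hT _ _, Complex.conj_ofReal, ← Finset.mul_sum]
  rw [← mul_assoc, hs]

theorem norm_maxEntangled [Nonempty R] (g : R → κ) : ‖maxEntangled g‖ = 1 := by
  classical
  have hone : HasMatrix (1 : ℓ²(R × κ, ℂ) →L[ℂ] ℓ²(R × κ, ℂ)) 1 := fun i j => by
    simp [ket_apply, one_apply]
  have hentry (k l : R) :
      (1 : Matrix (R × κ) (R × κ) ℂ) (k, g k) (l, g l) = if k = l then 1 else 0 := by
    rcases eq_or_ne k l with rfl | hkl <;> simp [*]
  have hinner : ⟪maxEntangled g, maxEntangled g⟫_ℂ = 1 := by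
    refine (inner_maxEntangled_apply g hone).trans ?_
    simp [hentry]
  rw [@norm_eq_sqrt_re_inner ℂ, hinner]
  simp

end MaximallyEntangled

section Entropy

variable {R A' B' A B : Type*}

theorem re_inner_maxEntangled_le [Fintype R] (M : Channel B' B) {ρ : TraceClass (R × (A' × B'))}
    (hρ : IsState ρ) {f : R → A} (hf : Function.Injective f) (b : B)
    {T : ℓ²(R × (A × B), ℂ) →L[ℂ] ℓ²(R × (A × B), ℂ)}
    (hT : HasMatrix T (amplify (mixingTensor A M) ρ)) :
    (⟪maxEntangled fun k => (f k, b), T (maxEntangled fun k => (f k, b))⟫_ℂ).re ≤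
      (Fintype.card R : ℝ)⁻¹ := by
  classical
  set τ := amplify M.toOperators (middleTrace ρ) with hτ
  have hdens : IsDensityMatrix τ := isDensityMatrix_amplify M (isState_middleTrace hρ)
  have hentry (k l : R) : amplify (mixingTensor A M) ρ (k, (f k, b)) (l, (f l, b)) =
      if k = l then τ (k, b) (k, b) else 0 := by
    rw [amplify_mixingTensor]
    rcases eq_or_ne k l with rfl | hkl <;> simp [prodLeftComm, hf.ne, *]
  have hsum : ∑ k, (τ (k, b) (k, b)).re ≤ 1 := by
    simpa using sum_le_hasSum (Finset.univ.map (.sectL R b))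
      (fun p _ => (Complex.nonneg_iff.1 hdens.1.diag_nonneg).1) (Complex.hasSum_re hdens.2)
  rw [inner_maxEntangled_apply _ hT]
  simp only [hentry, Finset.sum_ite_eq', Finset.mem_univ, if_true]
  have hcard : (Fintype.card R : ℂ)⁻¹ = ((Fintype.card R : ℝ)⁻¹ : ℝ) := by simp
  rw [hcard, Complex.re_ofReal_mul, Complex.re_sum]
  exact mul_le_of_le_one_right (by positivity) hsum

theorem logb_card_le_channelRelEntropy {R : Type} [Fintype R] [Nonempty R] [Nonempty B]
    {N : Channel (A' × B') (A × B)} (hN : IsUnitaryChannel N) (M : Channel B' B) {f : R → A}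
    (hf : Function.Injective f) :
    (Real.logb 2 (Fintype.card R) : ℝ) ≤ channelRelEntropy N.toOperators (mixingTensor A M) := by
  obtain ⟨b⟩ := ‹Nonempty B›
  have hφ := norm_maxEntangled fun k => (f k, b)
  obtain ⟨ρ, hρ, hout⟩ := hN.exists_amplify_eq_vecMulVec hφ
  obtain ⟨T, hT⟩ := exists_hasMatrix_amplify_mixingTensor A M hρ
  have hle := logb_inv_le_relEntropy hφ (posSemidef_amplify_mixingTensor A M hρ) hT (by positivity)
    (re_inner_maxEntangled_le M hρ hf b hT)
  rw [inv_inv, ← hout] at hle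
  exact hle.trans (le_iSup₂_of_le R inferInstance (le_iSup₂_of_le ρ hρ le_rfl))

theorem condEntropy_le_neg_logDim [Nonempty A] [Nonempty B] {N : Channel (A' × B') (A × B)}
    (hN : IsUnitaryChannel N) : condEntropy N ≤ -logDim A := by
  rw [condEntropy, EReal.neg_le_neg_iff, logDim]
  refine le_iInf fun M => ?_
  have hle {n : ℕ} (hn : 0 < n) {f : Fin n → A} (hf : Function.Injective f) :
      (Real.logb 2 n : ℝ) ≤ channelRelEntropy N.toOperators (mixingTensor A M) := by
    have := Fin.pos_iff_nonempty.1 hn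
    simpa only [Fintype.card_fin] using logb_card_le_channelRelEntropy hN M hf
  split_ifs with hA
  · exact hle Nat.card_pos (Finite.equivFin A).symm.injective
  · rw [not_finite_iff_infinite] at hA
    rw [top_le_iff, EReal.eq_top_iff_forall_lt]
    intro y
    obtain ⟨n, hn⟩ := exists_nat_gt ((2 : ℝ) ^ y)
    have hn0 : (0 : ℝ) < n := (Real.rpow_pos_of_pos two_pos y).trans hn
    refine lt_of_lt_of_le ?_ (hle (Nat.cast_pos.1 hn0)
      ((Infinite.natEmbedding A).injective.comp Fin.val_injective))
    rwa [EReal.coe_lt_coe_iff, Real.lt_logb_iff_rpow_lt one_lt_two hn0]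

end Entropy

end QChannel

end

theorem mainTheorem2_general {A' B' A B : Type*} [Nonempty A] [Nonempty B]
    (N : Channel (A' × B') (A × B)) :
    (IsSemicausal N → -logDim A ≤ condEntropy N) ∧
    (IsUnitaryChannel N → condEntropy N ≤ -logDim A) :=
  ⟨neg_logDim_le_condEntropy, condEntropy_le_neg_logDim⟩

theorem mainTheorem2 {A' B' A B : Type*} [Countable A'] [Countable B'] [Countable A] [Countable B]
    [Nonempty A'] [Nonempty B'] [Nonempty A] [Nonempty B] (N : Channel (A' × B') (A × B)) :
    (IsSemicausal N → -logDim A ≤ condEntropy N) ∧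
    (IsSemicausal N → IsUnitaryChannel N → condEntropy N = -logDim A) ∧
    (condEntropy N < -logDim A → IsSignaling N) :=
  have ⟨hSemicausal, hUnitary⟩ := mainTheorem2_general N
  ⟨hSemicausal, fun h hU => le_antisymm (hUnitary hU) (hSemicausal h),
    fun hlt h => hlt.not_ge (hSemicausal h)⟩
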